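/- Let $\varphi=(1+\sqrt5)/2$. Let $A$ be the Hurt--Sada array: row $0$ is $0,1,2,3,\ldots$, and for $n\ge 1$ row $n$ is obtained from row $n-1$ by moving its unique entry equal to $n$ by $n$ places to the right (each of the $n$ entries it jumps over moves one place to the left). Write $A[n,k]$ for the entry in row $n\ge 0$ and column $k\ge 0$, and let $d(n)=A[n,n]$. A Zeckendorf representation of $n\ge 0$ is a binary string $a_1a_2\cdots a_t$ (most significant digit first, leading zeros allowed) with no two adjacent $1$'s such that $n=\sum_{1\le i\le t}a_iF_{t+2-i}$, where $F_0=0$, $F_1=1$, $F_i=F_{i-1}+F_{i-2}$ are the Fibonacci numbers. (a) There is a deterministic finite automaton over the alphabet $\{0,1\}$ with $8$ states (in which transitions may be missing, a string being rejected if a required transition is missing) that decides whether $d(n)\ge n$ or $d(n)<n$: it accepts a binary string if and only if the string is a Zeckendorf representation of some $n\ge 0$ with $d(n)\ge n$. (b) For every $n\ge 0$, if $d(n)<n$ then $d(n)=\lfloor(4-2\varphi)n+(5-3\varphi)\rfloor$. (c) For every $n\ge 1$, if $d(n)\ge n$ then $d(n)=\lfloor(2\varphi-2)n\rfloor+1$.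 -/

import Mathlib

/-- The position (column) of the entry `n` in the row `r`. For the rows of the Hurt-Sada array the
entry occurs exactly once, see `hurtSada_existsUnique`. -/
noncomputable def entryPos (r : ℕ → ℕ) (n : ℕ) : ℕ := sInf {i | r i = n}

/-- The row obtained from `r` by moving the entry `n` by `n` places to the right; the `n` entries
that it jumps over move one place to the left. -/
noncomputable def jumpRow (n : ℕ) (r : ℕ → ℕ) (k : ℕ) : ℕ :=
  if k < entryPos r n then r k
  else if k < entryPos r n + n then r (k + 1)
  else if k = entryPos r n + n then n
  else r k

/-- The Hurt-Sada array: `hurtSada n k` is `A[n,k]`, the entry in row `n` and column `k`. -/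
noncomputable def hurtSada : ℕ → ℕ → ℕ
  | 0 => fun k => k
  | n + 1 => jumpRow (n + 1) (hurtSada n)

/-- The diagonal sequence `d(n) = A[n,n]`. -/
noncomputable def hurtSadaDiag (n : ℕ) : ℕ := hurtSada n n

theorem jumpRow_bijective {r : ℕ → ℕ} (hr : Function.Bijective r) (n : ℕ) :
    Function.Bijective (jumpRow n r) := by
  obtain ⟨p, hp⟩ := hr.2 n
  have hpos : entryPos r n = p := by
    have hs : {i | r i = n} = {p} := by
      ext i
      exact ⟨fun h => hr.1 (Eq.trans h hp.symm), fun h => by rw [Set.mem_singleton_iff.1 h]; exact hp⟩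
    rw [entryPos, hs, csInf_singleton]
  have key : ∀ k, jumpRow n r k =
      r (if k < p then k else if k < p + n then k + 1 else if k = p + n then p else k) := by
    intro k
    unfold jumpRow
    rw [hpos]
    split_ifs <;> simp [hp]
  constructor
  · intro a b hab
    rw [key, key] at hab
    have := hr.1 hab
    split_ifs at this <;> omega
  · intro m
    obtain ⟨i, rfl⟩ := hr.2 m
    refine ⟨if i < p then i else if i = p then p + n else if i ≤ p + n then i - 1 else i, ?_⟩
    rw [key]
    congr 1
    split_ifs <;> omega

theorem hurtSada_bijective (n : ℕ) : Function.Bijective (hurtSada n) := by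
  induction n with
  | zero => exact Function.bijective_id
  | succ n ih => exact jumpRow_bijective ih (n + 1)

/-- Every natural number occurs exactly once in every row of the array. -/
theorem hurtSada_existsUnique (n m : ℕ) : ∃! i, hurtSada n i = m :=
  (hurtSada_bijective n).existsUnique m

/-- The value `∑ aᵢ F_{t+2-i}` (`1 ≤ i ≤ t`) of a binary string `a₁ a₂ ⋯ a_t`, most significant
digit first. -/
def fibValue : List (Fin 2) → ℕ
  | [] => 0
  | a :: w => a.val * Nat.fib (w.length + 2) + fibValue w

/-- The binary string `w`, most significant digit first and possibly with leading zeros, is a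
Zeckendorf representation of `n`: no two adjacent digits are both `1`, and the value is `n`. -/
def IsZeckendorfString (w : List (Fin 2)) (n : ℕ) : Prop :=
  w.IsChain (fun a b => ¬ (a = 1 ∧ b = 1)) ∧ fibValue w = n

/-- A deterministic finite automaton with input alphabet `α` and set of states `σ` (to be taken
finite). As usual for automata given by transition diagrams, a state need not have an outgoing
transition for each letter. -/
structure PartialDFA (α σ : Type) where
  /-- the labeled transitions -/
  step : σ → α → Option σ
  /-- the initial state -/
  start : σ
  /-- the final (accepting) states -/
  accept : Set σ

/-- The state reached from `q` by reading a string, if the required transitions all exist. -/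
def PartialDFA.evalFrom {α σ : Type} (M : PartialDFA α σ) : σ → List α → Option σ
  | q, [] => some q
  | q, a :: w => (M.step q a).bind fun q' => M.evalFrom q' w

/-- A string is accepted if reading it from the initial state leads to a final state. -/
def PartialDFA.Accepts {α σ : Type} (M : PartialDFA α σ) (w : List α) : Prop :=
  ∃ q ∈ M.accept, M.evalFrom M.start w = some q

/-! Label column `k` of row `n` by `N = k + n + 2`. An entry jumped over moves left by one while the
row number grows by one, so its label never changes. The entry `n` has label `⌊(n+1)φ⌋` just before
its jump and `⌊(n+1)φ²⌋` just after it. By Beatty's theorem every `N > 0` is exactly one of `⌊iφ⌋`,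
`⌊jφ²⌋`; so in the moving window of row `n` the entry labelled `N` is `i - 1` or `j - 1`
(`isWythoffRow_hurtSada`).

On the diagonal `N = 2n + 2`. The lower case gives `d(n) ≥ n`, the upper case `d(n) < n`, and
solving for the index gives the two floor formulas.

For the automaton, let `m` be the value of the Zeckendorf string of `n` with all Fibonacci indices
lowered by one. The type of `2n + 2` depends only on the interval containing `n - mφ`, and reading a
digit acts on this number by a contracting affine map. Finitely many intervals, compatible with
these maps, serve as states. -/

open Real in
theorem goldenRatio_bounds : 1.618 < goldenRatio ∧ goldenRatio < 1.6181 := by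
  have h := goldenRatio_sq
  have h1 := one_lt_goldenRatio
  constructor <;> nlinarith

/-! ### Wythoff numbers and Beatty's theorem -/

/-- `N = ⌊iφ⌋`, i.e. `N` is the `i`-th lower Wythoff number. -/
def IsLowerWythoff (i N : ℕ) : Prop :=
  (N : ℝ) ≤ i * Real.goldenRatio ∧ i * Real.goldenRatio < N + 1

/-- `N = ⌊iφ²⌋`, i.e. `N` is the `i`-th upper Wythoff number. -/
def IsUpperWythoff (i N : ℕ) : Prop :=
  (N : ℝ) ≤ i * (Real.goldenRatio + 1) ∧ i * (Real.goldenRatio + 1) < N + 1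

theorem IsLowerWythoff.index_unique {i j N : ℕ} (hi : IsLowerWythoff i N)
    (hj : IsLowerWythoff j N) : i = j := by
  have hφ := Real.one_lt_goldenRatio
  obtain ⟨h1, h2⟩ := hi
  obtain ⟨h3, h4⟩ := hj
  rcases lt_trichotomy i j with h | h | h
  · have h' : (i : ℝ) + 1 ≤ j := by exact_mod_cast h
    nlinarith
  · exact h
  · have h' : (j : ℝ) + 1 ≤ i := by exact_mod_cast h
    nlinarith

theorem IsUpperWythoff.index_unique {i j N : ℕ} (hi : IsUpperWythoff i N)
    (hj : IsUpperWythoff j N) : i = j := by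
  have hφ := Real.one_lt_goldenRatio
  obtain ⟨h1, h2⟩ := hi
  obtain ⟨h3, h4⟩ := hj
  rcases lt_trichotomy i j with h | h | h
  · have h' : (i : ℝ) + 1 ≤ j := by exact_mod_cast h
    nlinarith
  · exact h
  · have h' : (j : ℝ) + 1 ≤ i := by exact_mod_cast h
    nlinarith

theorem goldenRatio_holderConjugate :
    (Real.goldenRatio).HolderConjugate (Real.goldenRatio + 1) := by
  rw [Real.holderConjugate_iff]
  refine ⟨Real.one_lt_goldenRatio, ?_⟩
  have h := Real.goldenRatio_sq
  have h0 := Real.goldenRatio_pos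
  generalize Real.goldenRatio = x at *
  field_simp
  linarith

theorem beattySeq_eq_iff {r : ℝ} {k N : ℤ} :
    beattySeq r k = N ↔ (N : ℝ) ≤ k * r ∧ k * r < N + 1 := by
  rw [beattySeq, Int.floor_eq_iff]

theorem not_isLowerWythoff_and_isUpperWythoff {i j N : ℕ} (hN : 0 < N)
    (hi : IsLowerWythoff i N) (hj : IsUpperWythoff j N) : False := by
  have hB := Real.goldenRatio_irrational.beattySeq_symmDiff_beattySeq_pos
    goldenRatio_holderConjugate
  have hmem : (N : ℤ) ∈ {n : ℤ | 0 < n} := by simpa using hN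
  rw [← hB, Set.mem_symmDiff] at hmem
  have hNr : (1 : ℝ) ≤ N := by exact_mod_cast hN
  have hpos : ∀ {k : ℕ} {r : ℝ}, (N : ℝ) ≤ k * r → (0 : ℤ) < k := by
    intro k r h
    rcases Nat.eq_zero_or_pos k with h0 | h0
    · subst h0
      norm_num at h
      linarith
    · exact_mod_cast h0
  have h1 : (N : ℤ) ∈ {x | ∃ k > 0, beattySeq Real.goldenRatio k = x} :=
    ⟨i, hpos hi.1, beattySeq_eq_iff.2 (by simpa [IsLowerWythoff] using hi)⟩
  have h2 : (N : ℤ) ∈ {x | ∃ k > 0, beattySeq (Real.goldenRatio + 1) k = x} :=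
    ⟨j, hpos hj.1, beattySeq_eq_iff.2 (by simpa [IsUpperWythoff] using hj)⟩
  rcases hmem with h | h
  · exact h.2 h2
  · exact h.2 h1

theorem exists_isLowerWythoff_or_isUpperWythoff {N : ℕ} (hN : 0 < N) :
    (∃ i, IsLowerWythoff i N) ∨ ∃ j, IsUpperWythoff j N := by
  have hB := Real.goldenRatio_irrational.beattySeq_symmDiff_beattySeq_pos
    goldenRatio_holderConjugate
  have hmem : (N : ℤ) ∈ {n : ℤ | 0 < n} := by simpa using hN
  rw [← hB, Set.mem_symmDiff] at hmem
  rcases hmem with ⟨⟨k, hk, h⟩, -⟩ | ⟨⟨k, hk, h⟩, -⟩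
  · lift k to ℕ using hk.le
    exact Or.inl ⟨k, by simpa [IsLowerWythoff] using beattySeq_eq_iff.1 h⟩
  · lift k to ℕ using hk.le
    exact Or.inr ⟨k, by simpa [IsUpperWythoff] using beattySeq_eq_iff.1 h⟩

/-! ### The column from which each entry jumps -/

/-- The column of the entry `n` in the row `n - 1` of the Hurt-Sada array. -/
noncomputable def jumpStart (n : ℕ) : ℕ := ⌊((n : ℝ) + 1) * (Real.goldenRatio - 1)⌋₊

theorem jumpStart_le (n : ℕ) : (jumpStart n : ℝ) ≤ (n + 1) * (Real.goldenRatio - 1) :=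
  Nat.floor_le (mul_nonneg (by positivity) (by linarith [Real.one_lt_goldenRatio]))

theorem lt_jumpStart_add_one (n : ℕ) :
    ((n : ℝ) + 1) * (Real.goldenRatio - 1) < jumpStart n + 1 :=
  Nat.lt_floor_add_one _

theorem natCast_ne_natCast_mul_goldenRatio (a : ℕ) {b : ℕ} (hb : b ≠ 0) :
    (a : ℝ) ≠ b * Real.goldenRatio :=
  fun h => (Real.goldenRatio_irrational.natCast_mul hb).ne_nat a h.symm

theorem jumpStart_eq {n a : ℕ} (h1 : (a : ℝ) ≤ (n + 1) * (Real.goldenRatio - 1))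
    (h2 : ((n : ℝ) + 1) * (Real.goldenRatio - 1) < a + 1) : jumpStart n = a :=
  (Nat.floor_eq_iff (a.cast_nonneg.trans h1)).2 ⟨h1, h2⟩

theorem jumpStart_zero : jumpStart 0 = 0 := by
  have := goldenRatio_bounds
  apply jumpStart_eq <;> norm_num <;> linarith

theorem jumpStart_one : jumpStart 1 = 1 := by
  have := goldenRatio_bounds
  apply jumpStart_eq <;> norm_num <;> linarith

theorem jumpStart_two : jumpStart 2 = 1 := by
  have := goldenRatio_bounds
  apply jumpStart_eq <;> norm_num <;> linarith

theorem jumpStart_le_succ (n : ℕ) : jumpStart n ≤ jumpStart (n + 1) := by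
  apply Nat.floor_le_floor
  push_cast
  nlinarith [Real.one_lt_goldenRatio]

theorem jumpStart_succ_le (n : ℕ) : jumpStart (n + 1) ≤ jumpStart n + 1 := by
  have h1 := jumpStart_le (n + 1)
  have h2 := lt_jumpStart_add_one n
  have h3 := Real.goldenRatio_lt_two
  push_cast at h1
  have : (jumpStart (n + 1) : ℝ) < jumpStart n + 1 + 1 := by nlinarith
  exact Nat.lt_succ_iff.1 (by exact_mod_cast this)

theorem jumpStart_le_self {n : ℕ} (hn : 1 ≤ n) : jumpStart (n + 1) ≤ n := by
  induction n, hn using Nat.le_induction with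
  | base => exact jumpStart_two.le
  | succ n hn ih => exact (jumpStart_succ_le _).trans (by omega)

theorem isLowerWythoff_jumpStart (n : ℕ) : IsLowerWythoff (n + 1) (jumpStart n + n + 1) := by
  have h1 := jumpStart_le n
  have h2 := lt_jumpStart_add_one n
  constructor <;> push_cast <;> linarith

theorem isUpperWythoff_jumpStart (n : ℕ) :
    IsUpperWythoff (n + 1) (jumpStart n + 2 * n + 2) := by
  have h1 := jumpStart_le n
  have h2 := lt_jumpStart_add_one n
  constructor <;> push_cast <;> linarith

/-- Used when the left fixed part grows: it identifies the entry arriving in the newly fixed column.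
A floor increment puts an integer between two consecutive multiples of `1/φ = φ - 1`; multiplying by
`φ` gives the claim, with strictness from irrationality. -/
theorem isUpperWythoff_of_jumpStart_succ {n : ℕ} (h : jumpStart (n + 1) = jumpStart n + 1) :
    IsUpperWythoff (jumpStart n + 1) (jumpStart n + n + 2) := by
  have hg := Real.one_lt_goldenRatio
  have hsq := Real.goldenRatio_sq
  have h1 := lt_jumpStart_add_one n
  have h2 := jumpStart_le (n + 1)
  have h3 := natCast_ne_natCast_mul_goldenRatio (n + 2) (b := jumpStart n + 1) (by omega)
  rw [h] at h2
  push_cast at h2 h3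
  have h4 := mul_lt_mul_of_pos_right h1 Real.goldenRatio_pos
  have h5 := mul_le_mul_of_nonneg_right h2 Real.goldenRatio_pos.le
  have e1 : ((n : ℝ) + 1) * (Real.goldenRatio - 1) * Real.goldenRatio = n + 1 := by
    linear_combination ((n : ℝ) + 1) * hsq
  have e2 : ((n : ℝ) + 1 + 1) * (Real.goldenRatio - 1) * Real.goldenRatio = n + 2 := by
    linear_combination ((n : ℝ) + 2) * hsq
  rw [e1] at h4
  rw [e2] at h5
  have h6 := lt_of_le_of_ne h5 h3.symm
  constructor <;> push_cast <;> linarith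

/-- Covers the entries pulled in from the untouched right part: column `k + 1` holds `k + 1`, of
index `k + 2`. The bounds say `n + 1 < (k+2)/φ < n + 2`, and `(k+2)φ = (k+2) + (k+2)/φ`. -/
theorem isLowerWythoff_of_jumpStart_le {n k : ℕ} (h1 : n + jumpStart n ≤ k)
    (h2 : k ≤ n + jumpStart (n + 1)) : IsLowerWythoff (k + 2) (k + n + 3) := by
  have hg := Real.one_lt_goldenRatio
  have hsq := Real.goldenRatio_sq
  have h3 := lt_jumpStart_add_one n
  have h4 := jumpStart_le (n + 1)
  have h1' : (n : ℝ) + jumpStart n ≤ k := by exact_mod_cast h1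
  have h2' : (k : ℝ) ≤ n + jumpStart (n + 1) := by exact_mod_cast h2
  push_cast at h4
  have h5 : ((n : ℝ) + 1) * Real.goldenRatio < k + 2 := by linarith
  have h6 : (k : ℝ) + 2 ≤ (n + 2) * Real.goldenRatio := by linarith
  have h7 := natCast_ne_natCast_mul_goldenRatio (k + 2) (b := n + 2) (by omega)
  push_cast at h7
  have h8 := lt_of_le_of_ne h6 h7
  have hg' : 0 < Real.goldenRatio - 1 := by linarith
  have h9 := mul_lt_mul_of_pos_right h5 hg'
  have h10 := mul_lt_mul_of_pos_right h8 hg'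
  constructor <;> push_cast <;> nlinarith

/-! ### Rows of the array in terms of Wythoff numbers -/

/-- The entries of the row `n` of the Hurt-Sada array, described by Wythoff numbers. -/
structure IsWythoffRow (n : ℕ) (r : ℕ → ℕ) : Prop where
  left : ∀ k < jumpStart (n + 1), r k = k
  right : ∀ k, n + jumpStart n < k → r k = k
  lower : ∀ k i, jumpStart (n + 1) ≤ k → k ≤ n + jumpStart n →
    IsLowerWythoff i (k + n + 2) → r k + 1 = i
  upper : ∀ k j, jumpStart (n + 1) ≤ k → k ≤ n + jumpStart n →
    IsUpperWythoff j (k + n + 2) → r k + 1 = j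

theorem IsWythoffRow.apply_jumpStart {n : ℕ} {r : ℕ → ℕ} (h : IsWythoffRow n r) :
    r (jumpStart (n + 1)) = n + 1 := by
  rcases le_or_gt (jumpStart (n + 1)) (n + jumpStart n) with hle | hlt
  · have := h.lower _ (n + 2) le_rfl hle (by
      have := isLowerWythoff_jumpStart (n + 1)
      rwa [show jumpStart (n + 1) + (n + 1) + 1 = jumpStart (n + 1) + n + 2 by ring] at this)
    omega
  · rw [h.right _ hlt]
    have h1 := jumpStart_succ_le n
    obtain rfl : n = 0 := by omega
    exact jumpStart_one

theorem entryPos_eq {r : ℕ → ℕ} (hr : Function.Injective r) {n i : ℕ} (h : r i = n) :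
    entryPos r n = i := by
  have hs : {i | r i = n} = {i} := by
    ext j
    exact ⟨fun hj => hr (Eq.trans hj h.symm), fun hj => by rw [Set.mem_singleton_iff.1 hj]; exact h⟩
  rw [entryPos, hs, csInf_singleton]

theorem IsWythoffRow.jumpRow {n : ℕ} {r : ℕ → ℕ} (h : IsWythoffRow n r)
    (hr : Function.Injective r) : IsWythoffRow (n + 1) (jumpRow (n + 1) r) := by
  have hpos := entryPos_eq hr h.apply_jumpStart
  have hs1 := jumpStart_succ_le n
  have hs2 := jumpStart_succ_le (n + 1)
  have hm1 := jumpStart_le_succ n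
  have hm2 := jumpStart_le_succ (n + 1)
  have hdef : ∀ k, _root_.jumpRow (n + 1) r k =
      if k < jumpStart (n + 1) then r k
      else if k < jumpStart (n + 1) + (n + 1) then r (k + 1)
      else if k = jumpStart (n + 1) + (n + 1) then n + 1 else r k := by
    intro k
    rw [_root_.jumpRow, hpos]
  have hwrap : ∀ k, n + jumpStart n < k + 1 → k < jumpStart (n + 1) + (n + 1) →
      IsLowerWythoff (k + 2) (k + (n + 1) + 2) := by
    intro k h1 h2
    have := isLowerWythoff_of_jumpStart_le (n := n) (k := k) (by omega) (by omega)
    rwa [show k + n + 3 = k + (n + 1) + 2 by ring] at this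
  -- The label at the landing column is upper Wythoff of index `n + 2`, matching the entry `n + 1`.
  have hend : IsUpperWythoff (n + 2) (jumpStart (n + 1) + (n + 1) + (n + 1) + 2) := by
    have := isUpperWythoff_jumpStart (n + 1)
    rwa [show jumpStart (n + 1) + 2 * (n + 1) + 2
      = jumpStart (n + 1) + (n + 1) + (n + 1) + 2 by ring] at this
  refine ⟨?_, ?_, ?_, ?_⟩
  · intro k hk
    rw [hdef]
    rcases lt_or_ge k (jumpStart (n + 1)) with hlt | hge
    · rw [if_pos hlt, h.left k hlt]
    · rw [if_neg hge.not_gt, if_pos (by omega)]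
      obtain rfl : k = jumpStart (n + 1) := by omega
      have hjump : jumpStart (n + 1 + 1) = jumpStart (n + 1) + 1 := by omega
      rcases le_or_gt (jumpStart (n + 1) + 1) (n + jumpStart n) with hle | hgt
      · have := h.upper _ (jumpStart (n + 1) + 1) (by omega) hle (by
          have := isUpperWythoff_of_jumpStart_succ hjump
          rwa [show jumpStart (n + 1) + (n + 1) + 2 = jumpStart (n + 1) + 1 + n + 2 by ring]
            at this)
        omega
      -- Here the window is too short to contain the next column, which happens only for tiny `n`.
      · exfalso
        have hn : n < 2 := by omega
        have h0 := jumpStart_zero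
        have h1 := jumpStart_one
        have h2 := jumpStart_two
        interval_cases n
        · norm_num at *
          omega
        · norm_num at *
          omega
  · intro k hk
    rw [hdef, if_neg (by omega), if_neg (by omega), if_neg (by omega), h.right k (by omega)]
  · intro k i h1 h2 hi
    rw [hdef, if_neg (by omega)]
    split_ifs with hlt heq
    · rcases le_or_gt (k + 1) (n + jumpStart n) with hle | hgt
      · exact h.lower _ i (by omega) hle (by
          rwa [show k + 1 + n + 2 = k + (n + 1) + 2 by ring])
      · rw [h.right _ hgt]
        exact (hwrap k hgt hlt).index_unique hi
    · subst heq
      exact (not_isLowerWythoff_and_isUpperWythoff (by omega) hi hend).elim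
    · omega
  · intro k j h1 h2 hj
    rw [hdef, if_neg (by omega)]
    split_ifs with hlt heq
    · rcases le_or_gt (k + 1) (n + jumpStart n) with hle | hgt
      · exact h.upper _ j (by omega) hle (by
          rwa [show k + 1 + n + 2 = k + (n + 1) + 2 by ring])
      · exact (not_isLowerWythoff_and_isUpperWythoff (by omega) (hwrap k hgt hlt) hj).elim
    · subst heq
      exact hend.index_unique hj
    · omega

theorem isWythoffRow_hurtSada (n : ℕ) : IsWythoffRow n (hurtSada n) := by
  induction n with
  | zero =>
    refine ⟨fun _ _ => rfl, fun _ _ => rfl, ?_, ?_⟩ <;>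
    · intro k i h1 h2
      have h3 := jumpStart_zero
      have h4 := jumpStart_one
      norm_num at h1 h2
      omega
  | succ n ih => exact ih.jumpRow (hurtSada_bijective n).1

/-! ### The diagonal and its floor formulas -/

theorem hurtSadaDiag_of_isLowerWythoff {n i : ℕ} (hn : 1 ≤ n)
    (h : IsLowerWythoff i (2 * n + 2)) : hurtSadaDiag n + 1 = i :=
  (isWythoffRow_hurtSada n).lower n i (jumpStart_le_self hn) (by omega) (by
    rwa [show n + n + 2 = 2 * n + 2 by ring])

theorem hurtSadaDiag_of_isUpperWythoff {n j : ℕ} (hn : 1 ≤ n)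
    (h : IsUpperWythoff j (2 * n + 2)) : hurtSadaDiag n + 1 = j :=
  (isWythoffRow_hurtSada n).upper n j (jumpStart_le_self hn) (by omega) (by
    rwa [show n + n + 2 = 2 * n + 2 by ring])

theorem le_hurtSadaDiag_of_isLowerWythoff {n i : ℕ} (hn : 1 ≤ n)
    (h : IsLowerWythoff i (2 * n + 2)) : n ≤ hurtSadaDiag n := by
  have hd := hurtSadaDiag_of_isLowerWythoff hn h
  have h1 := h.1
  rw [← hd] at h1
  push_cast at h1
  have h2 := Real.goldenRatio_lt_two
  have : (n : ℝ) + 1 ≤ hurtSadaDiag n + 1 := by nlinarith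
  exact_mod_cast (by linarith : (n : ℝ) ≤ hurtSadaDiag n)

theorem hurtSadaDiag_lt_of_isUpperWythoff {n j : ℕ} (hn : 1 ≤ n)
    (h : IsUpperWythoff j (2 * n + 2)) : hurtSadaDiag n < n := by
  have hd := hurtSadaDiag_of_isUpperWythoff hn h
  have h1 := h.2
  rw [← hd] at h1
  push_cast at h1
  have h2 := goldenRatio_bounds.1
  have h3 : (1 : ℝ) ≤ n := by exact_mod_cast hn
  by_contra! hc
  have h4 : (n : ℝ) ≤ hurtSadaDiag n := by exact_mod_cast hc
  nlinarith

theorem hurtSadaDiag_eq_floor_of_lt {n : ℕ} (h : hurtSadaDiag n < n) :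
    (hurtSadaDiag n : ℤ) =
      ⌊(4 - 2 * Real.goldenRatio) * (n : ℝ) + (5 - 3 * Real.goldenRatio)⌋ := by
  have hn : 1 ≤ n := by omega
  rcases exists_isLowerWythoff_or_isUpperWythoff (N := 2 * n + 2) (by omega) with ⟨i, hi⟩ | ⟨j, hj⟩
  · exact absurd (le_hurtSadaDiag_of_isLowerWythoff hn hi) (by omega)
  · have hd := hurtSadaDiag_of_isUpperWythoff hn hj
    obtain ⟨h1, h2⟩ := hj
    rw [← hd] at h1 h2
    push_cast at h1 h2
    obtain ⟨hb1, hb2⟩ := goldenRatio_bounds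
    have hsq := Real.goldenRatio_sq
    -- `2 - φ = φ⁻²`, so multiplying by it isolates the index.
    have hpos : 0 < 2 - Real.goldenRatio := by linarith
    have h3 := mul_le_mul_of_nonneg_right h1 hpos.le
    have h4 := mul_lt_mul_of_pos_right h2 hpos
    have e : ((hurtSadaDiag n : ℝ) + 1) * (Real.goldenRatio + 1) * (2 - Real.goldenRatio)
        = hurtSadaDiag n + 1 := by
      linear_combination (-((hurtSadaDiag n : ℝ) + 1)) * hsq
    rw [e] at h3 h4
    rw [eq_comm, Int.floor_eq_iff]
    push_cast
    constructor <;> linarith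

theorem hurtSadaDiag_eq_floor_of_le {n : ℕ} (hn : 1 ≤ n) (h : n ≤ hurtSadaDiag n) :
    (hurtSadaDiag n : ℤ) = ⌊(2 * Real.goldenRatio - 2) * (n : ℝ)⌋ + 1 := by
  rcases exists_isLowerWythoff_or_isUpperWythoff (N := 2 * n + 2) (by omega) with ⟨i, hi⟩ | ⟨j, hj⟩
  · have hd := hurtSadaDiag_of_isLowerWythoff hn hi
    obtain ⟨h1, h2⟩ := hi
    rw [← hd] at h1 h2
    push_cast at h1 h2
    obtain ⟨hb1, hb2⟩ := goldenRatio_bounds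
    have hsq := Real.goldenRatio_sq
    have hpos : 0 < Real.goldenRatio - 1 := by linarith
    have h3 := mul_le_mul_of_nonneg_right h1 hpos.le
    have h4 := mul_lt_mul_of_pos_right h2 hpos
    have e : ((hurtSadaDiag n : ℝ) + 1) * Real.goldenRatio * (Real.goldenRatio - 1)
        = hurtSadaDiag n + 1 := by
      linear_combination ((hurtSadaDiag n : ℝ) + 1) * hsq
    rw [e] at h3 h4
    rw [← sub_eq_iff_eq_add, eq_comm, Int.floor_eq_iff]
    push_cast
    constructor <;> linarith
  · exact absurd (hurtSadaDiag_lt_of_isUpperWythoff hn hj) (by omega)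

/-! ### The automaton -/

/-- The automaton of the diagonal. State `0` is reached by the strings `0⋯0`; the other states
correspond to the intervals of `DiagStateInv`. -/
def diagDFA : PartialDFA (Fin 2) (Fin 8) where
  step q a := match q, a with
    | 0, 0 => some 0
    | 0, 1 => some 2
    | 1, 0 => some 7
    | 2, 0 => some 7
    | 3, 0 => some 6
    | 4, 0 => some 6
    | 4, 1 => some 3
    | 5, 0 => some 5
    | 5, 1 => some 2
    | 6, 0 => some 5
    | 6, 1 => some 1
    | 7, 0 => some 4
    | 7, 1 => some 1
    | _, _ => none
  start := 0
  accept := {0, 2, 3, 4, 6, 7}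

/-- The last digit read on the way to a state of `diagDFA`. -/
def diagLastDigit : Fin 8 → Fin 2 := ![0, 1, 1, 1, 0, 0, 0, 0]

open Real in
/-- The property of the Fibonacci value `a` of a string leading to the state `q`, and of the value
`b` of the same string with all Fibonacci indices lowered by one. -/
def DiagStateInv (q : Fin 8) (a b : ℕ) : Prop :=
  match q with
  | 0 => a = 0 ∧ b = 0
  | 1 => 1 ≤ a ∧ (-1 : ℝ) < a - b * goldenRatio ∧ a - b * goldenRatio < (goldenRatio - 3) / 2
  | 2 => 1 ≤ a ∧ (goldenRatio - 3) / 2 < a - b * goldenRatio ∧ a - b * goldenRatio < -1 / 2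
  | 3 => 1 ≤ a ∧ (-1 / 2 : ℝ) < a - b * goldenRatio ∧ a - b * goldenRatio < goldenRatio - 2
  | 4 => 1 ≤ a ∧ goldenRatio - 2 < a - b * goldenRatio ∧
      a - b * goldenRatio < (goldenRatio - 2) / 2
  | 5 => 1 ≤ a ∧ (goldenRatio - 2) / 2 < a - b * goldenRatio ∧
      a - b * goldenRatio < goldenRatio - 3 / 2
  | 6 => 1 ≤ a ∧ goldenRatio - 3 / 2 < a - b * goldenRatio ∧
      a - b * goldenRatio < (goldenRatio - 1) / 2
  | 7 => 1 ≤ a ∧ (goldenRatio - 1) / 2 < a - b * goldenRatio ∧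
      a - b * goldenRatio < goldenRatio - 1

/-- With `x = a - bφ`, reading `d` replaces `x` by `(1 - φ)(x + d)`. The cut points are those where
the type of `2n + 2` changes, their preimages `(φ-1)/2` and `-1/2`, and `φ - 2`, which separates
last digit `1` from `0`. State `0` stands apart because `x = 0` lies in the rejecting interval of
state `5`, yet `d(0) ≥ 0`. -/
theorem DiagStateInv.step {q q' : Fin 8} {d : Fin 2} {a b : ℕ} (h : DiagStateInv q a b)
    (hq : diagDFA.step q d = some q') : DiagStateInv q' (a + b + d.val) (a + d.val) := by
  obtain ⟨hb1, hb2⟩ := goldenRatio_bounds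
  have hsq := Real.goldenRatio_sq
  have hpos : 0 < Real.goldenRatio - 1 := by linarith
  -- Since `1 - φ < 0`, the endpoints swap.
  have key : ∀ {lo hi : ℝ}, lo < a - b * Real.goldenRatio → a - b * Real.goldenRatio < hi →
      ((1 : ℝ) - Real.goldenRatio) * (hi + d.val)
        < (a + b + d.val : ℕ) - (a + d.val : ℕ) * Real.goldenRatio ∧
      (a + b + d.val : ℕ) - (a + d.val : ℕ) * Real.goldenRatio
        < ((1 : ℝ) - Real.goldenRatio) * (lo + d.val) := by
    intro lo hi h1 h2
    have e : ((a + b + d.val : ℕ) : ℝ) - (a + d.val : ℕ) * Real.goldenRatio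
        = (1 - Real.goldenRatio) * (a - b * Real.goldenRatio + d.val) := by
      push_cast
      linear_combination (-(b : ℝ)) * hsq
    rw [e]
    constructor <;> nlinarith
  fin_cases q <;> fin_cases d <;> simp [diagDFA] at hq <;> subst hq <;>
    simp only [DiagStateInv] at h ⊢
  · obtain ⟨rfl, rfl⟩ := h
    simp
  · obtain ⟨rfl, rfl⟩ := h
    norm_num
    constructor <;> linarith
  all_goals
    obtain ⟨h0, h1, h2⟩ := h
    have h3 := key h1 h2
    refine ⟨Nat.le_add_right_of_le (Nat.le_add_right_of_le h0), ?_, ?_⟩ <;>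
    · push_cast at h3 ⊢
      norm_num only at h3 ⊢
      linarith [h3.1, h3.2]

theorem diagDFA_evalFrom_inv {w : List (Fin 2)} {q q' : Fin 8} {a b : ℕ}
    (h : DiagStateInv q a b) (hw : diagDFA.evalFrom q w = some q') :
    ∃ c, DiagStateInv q'
      (a * Nat.fib (w.length + 1) + b * Nat.fib w.length + fibValue w) c := by
  induction w generalizing q a b with
  | nil =>
    obtain rfl : q = q' := by simpa [PartialDFA.evalFrom] using hw
    exact ⟨b, by simpa [fibValue] using h⟩
  | cons d w ih =>
    rw [PartialDFA.evalFrom, Option.bind_eq_some_iff] at hw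
    obtain ⟨q₁, hq₁, hw⟩ := hw
    obtain ⟨c, hc⟩ := ih (h.step hq₁) hw
    refine ⟨c, ?_⟩
    convert hc using 1
    rw [fibValue, List.length_cons, Nat.fib_add_two]
    ring

theorem diagDFA_step_isSome_iff (q : Fin 8) (d : Fin 2) :
    (∃ q', diagDFA.step q d = some q') ↔ ¬ (diagLastDigit q = 1 ∧ d = 1) := by
  fin_cases q <;> fin_cases d <;> simp [diagDFA, diagLastDigit]

theorem diagLastDigit_of_step {q q' : Fin 8} {d : Fin 2} (h : diagDFA.step q d = some q') :
    diagLastDigit q' = d := by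
  fin_cases q <;> fin_cases d <;> simp [diagDFA] at h <;> subst h <;> simp [diagLastDigit]

theorem diagDFA_evalFrom_isSome_iff (q : Fin 8) (w : List (Fin 2)) :
    (∃ q', diagDFA.evalFrom q w = some q') ↔
      (diagLastDigit q :: w).IsChain (fun a b => ¬ (a = 1 ∧ b = 1)) := by
  induction w generalizing q with
  | nil => simp [PartialDFA.evalFrom]
  | cons d w ih =>
    rw [List.isChain_cons_cons, ← diagDFA_step_isSome_iff]
    constructor
    · rintro ⟨q', h⟩
      rw [PartialDFA.evalFrom, Option.bind_eq_some_iff] at h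
      obtain ⟨q₁, hq₁, h⟩ := h
      refine ⟨⟨q₁, hq₁⟩, ?_⟩
      rw [← diagLastDigit_of_step hq₁]
      exact (ih q₁).1 ⟨q', h⟩
    · rintro ⟨⟨q₁, hq₁⟩, h⟩
      rw [← diagLastDigit_of_step hq₁] at h
      obtain ⟨q', h⟩ := (ih q₁).2 h
      exact ⟨q', by rw [PartialDFA.evalFrom, hq₁, Option.bind_some, h]⟩

theorem diagDFA_eval_isSome_iff (w : List (Fin 2)) :
    (∃ q, diagDFA.evalFrom diagDFA.start w = some q) ↔
      w.IsChain (fun a b => ¬ (a = 1 ∧ b = 1)) := by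
  rw [diagDFA_evalFrom_isSome_iff]
  cases w with
  | nil => simp
  | cons d w => simp [diagDFA, diagLastDigit]

/-- Since `m ≈ n/φ` and `n - m ≈ n/φ²`, the index for `2n + 2` is near `2m` in the lower case and
near `2(n - m)` in the upper; the interval decides whether to add `1` or `2`. -/
theorem DiagStateInv.mem_accept_iff {q : Fin 8} {n m : ℕ} (h : DiagStateInv q n m) :
    q ∈ diagDFA.accept ↔ n ≤ hurtSadaDiag n := by
  obtain ⟨hb1, hb2⟩ := goldenRatio_bounds
  have hsq := Real.goldenRatio_sq
  have hlow : ∀ i : ℕ, 1 ≤ n → IsLowerWythoff i (2 * n + 2) → n ≤ hurtSadaDiag n :=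
    fun i => le_hurtSadaDiag_of_isLowerWythoff
  have hupp : ∀ j : ℕ, 1 ≤ n → IsUpperWythoff j (2 * n + 2) → ¬ n ≤ hurtSadaDiag n :=
    fun j hn hj => (hurtSadaDiag_lt_of_isUpperWythoff hn hj).not_ge
  have hindex : (-1 : ℝ) < n - m * Real.goldenRatio → m ≤ n := by
    intro hx
    have h1 : (0 : ℝ) ≤ m * (Real.goldenRatio - 1) :=
      mul_nonneg m.cast_nonneg (by linarith)
    have h2 : (m : ℝ) < n + 1 := by linarith
    exact Nat.lt_succ_iff.1 (by exact_mod_cast h2)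
  have hcast : m ≤ n → ((n - m : ℕ) : ℝ) = n - m := Nat.cast_sub
  have hinv : ∀ {x y : ℝ}, x < y → x * Real.goldenRatio < y * Real.goldenRatio :=
    fun hxy => mul_lt_mul_of_pos_right hxy Real.goldenRatio_pos
  fin_cases q <;> simp only [DiagStateInv] at h
  · obtain ⟨rfl, -⟩ := h
    simp [diagDFA]
  · obtain ⟨hn, h1, h2⟩ := h
    have hmn := hindex h1
    refine iff_of_false (by simp [diagDFA]) (hupp (2 * (n - m) + 2) hn ?_)
    have h3 := hinv h1
    have h4 := hinv h2
    constructor <;> push_cast [hcast hmn] <;> nlinarith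
  · obtain ⟨hn, h1, h2⟩ := h
    refine iff_of_true (by simp [diagDFA]) (hlow (2 * m + 1) hn ?_)
    constructor <;> push_cast <;> linarith
  · obtain ⟨hn, h1, h2⟩ := h
    refine iff_of_true (by simp [diagDFA]) (hlow (2 * m + 1) hn ?_)
    constructor <;> push_cast <;> linarith
  · obtain ⟨hn, h1, h2⟩ := h
    refine iff_of_true (by simp [diagDFA]) (hlow (2 * m + 1) hn ?_)
    constructor <;> push_cast <;> linarith
  · obtain ⟨hn, h1, h2⟩ := h
    have hmn := hindex (by linarith)
    refine iff_of_false (by simp [diagDFA]) (hupp (2 * (n - m) + 1) hn ?_)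
    have h3 := hinv h1
    have h4 := hinv h2
    constructor <;> push_cast [hcast hmn] <;> nlinarith
  · obtain ⟨hn, h1, h2⟩ := h
    refine iff_of_true (by simp [diagDFA]) (hlow (2 * m + 2) hn ?_)
    constructor <;> push_cast <;> linarith
  · obtain ⟨hn, h1, h2⟩ := h
    refine iff_of_true (by simp [diagDFA]) (hlow (2 * m + 2) hn ?_)
    constructor <;> push_cast <;> linarith

theorem theorem8 :
    (∃ M : PartialDFA (Fin 2) (Fin 8),
      (∀ (n : ℕ) (w : List (Fin 2)), IsZeckendorfString w n →
        (M.Accepts w ↔ n ≤ hurtSadaDiag n)) ∧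
      (∀ w : List (Fin 2), M.Accepts w → ∃ n : ℕ, IsZeckendorfString w n)) ∧
    (∀ n : ℕ, hurtSadaDiag n < n →
      (hurtSadaDiag n : ℤ) =
        ⌊(4 - 2 * Real.goldenRatio) * (n : ℝ) + (5 - 3 * Real.goldenRatio)⌋) ∧
    (∀ n : ℕ, 1 ≤ n → n ≤ hurtSadaDiag n →
      (hurtSadaDiag n : ℤ) = ⌊(2 * Real.goldenRatio - 2) * (n : ℝ)⌋ + 1) := by
  refine ⟨⟨diagDFA, ?_, ?_⟩, fun n => hurtSadaDiag_eq_floor_of_lt,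
    fun n => hurtSadaDiag_eq_floor_of_le⟩
  · rintro n w ⟨hw, rfl⟩
    obtain ⟨q, hq⟩ := (diagDFA_eval_isSome_iff w).2 hw
    have hstart : DiagStateInv diagDFA.start 0 0 := ⟨rfl, rfl⟩
    obtain ⟨c, hc⟩ := diagDFA_evalFrom_inv hstart hq
    rw [zero_mul, zero_mul, zero_add, zero_add] at hc
    rw [← hc.mem_accept_iff]
    constructor
    · rintro ⟨q', hq', he⟩
      rw [hq, Option.some_inj] at he
      rwa [he]
    · exact fun h => ⟨q, h, hq⟩
  · rintro w ⟨q, -, hq⟩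
    exact ⟨fibValue w, (diagDFA_eval_isSome_iff w).1 ⟨q, hq⟩, rfl⟩
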